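/- **Setting.** Let $K$ streams $X_k=\{X_k(n):n\in\mathbb N\}$, $k\in[K]=\{1,\dots,K\}$, $\mathbb N=\{1,2,\dots\}$, be given, $X_k$ taking values in an arbitrary measurable space, and let $\mathcal F_k(n)=\sigma(X_k(1),\dots,X_k(n))$, $\mathcal F(n)=\sigma(\mathcal F_k(n),k\in[K])$. For each $k$ let $\mathrm P_k^0,\mathrm P_k^1$ be two laws of $X_k$ that are mutually absolutely continuous on $\mathcal F_k(n)$ for every $n$, with log-likelihood ratio $\lambda_k(n)=\log\frac{d\mathrm P_k^1}{d\mathrm P_k^0}(\mathcal F_k(n))$. For $A\subseteq[K]$ (the set of signals) let $\mathrm P_A$ be the law of $(X_1,\dots,X_K)$ under which the streams are independent, $X_k$ having law $\mathrm P_k^1$ if $k\in A$ and $\mathrm P_k^0$ if $k\notin A$; $\mathrm E_A$ is the expectation under $\mathrm P_A$. Assume that there are positive numbers $I_k,J_k$ such that for every $k\in[K]$ $$\mathrm P_k^1\Big(\limsup_n \tfrac{\lambda_k(n)}n\le I_k\Big)=1,\qquad \mathrm P_k^0\Big(\limsup_n \tfrac{-\lambda_k(n)}n\le J_k\Big)=1,$$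 $$\sum_{n\ge1}\mathrm P_k^1\Big(\tfrac{\lambda_k(n)}n\le I_k-\epsilon\Big)<\infty,\qquad \sum_{n\ge1}\mathrm P_k^0\Big(\tfrac{-\lambda_k(n)}n\le J_k-\epsilon\Big)<\infty\qquad\text{for all }\epsilon>0.$$ A *procedure* $\chi=(\mathbf T,\mathbf D)$ consists of random times $T_k\in\mathbb N\cup\{\infty\}$ and decisions $D_k\in\{0,1\}$ with $\{T_k=n\},\{T_k=n,D_k=i\}\in\mathcal F(n)$ for all $k\in[K]$, $n\in\mathbb N$, $i\in\{0,1\}$; it is *decentralized* ($\chi\in\Delta'$) if $\mathcal F(n)$ can be replaced by $\mathcal F_k(n)$. For a class $\Pi$ of subsets of $[K]$ and $\alpha,\beta\in(0,1)$, $\Delta(\alpha,\beta,\Pi)$ is the set of procedures such that, for every $A\in\Pi$, $\mathrm P_A(T_k<\infty)=1$ for all $k\in[K]$, $\mathrm P_A(\exists j\notin A: D_j=1)\le\alpha$ and $\mathrm P_A(\exists i\in A: D_i=0)\le\beta$. Let $$\mathcal L'_{k,A}(\alpha,\beta,\Pi)=\inf\{\mathrm E_A[T_k]:(\mathbf T,\mathbf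 D)\in\Delta'\cap\Delta(\alpha,\beta,\Pi)\}.$$ The *parallel SPRT* $\tilde\chi=(\tilde{\mathbf T},\tilde{\mathbf D})$ with thresholds $a,b>0$ is $\tilde T_k=\inf\{n\in\mathbb N:\lambda_k(n)\notin(-b,a)\}$, $\tilde D_k=\mathbf 1\{\tilde T_k<\infty,\ \lambda_k(\tilde T_k)\ge a\}$. All limits are as $\alpha,\beta\downarrow0$ jointly, with no relation imposed between $\alpha$ and $\beta$, and $x\sim y$ means $x/y\to1$. **Theorem.** Let $\Pi$ be such that for every $k\in[K]$ there are $A,B\in\Pi$ with $k\in A$ and $k\notin B$. Suppose that the thresholds $a=a(\alpha,\beta)>0$, $b=b(\alpha,\beta)>0$ are such that $\tilde\chi\in\Delta(\alpha,\beta,\Pi)$ for all $\alpha,\beta\in(0,1)$, and $a\sim|\log\alpha|$, $b\sim|\log\beta|$. Then $\tilde\chi\in\Delta'\cap\Delta(\alpha,\beta,\Pi)$ for all $\alpha,\beta\in(0,1)$ and, for every $A\in\Pi$, $i\in A$, $j\notin A$, $$\mathrm E_A[\tilde T_i]\sim\mathcal L'_{i,A}(\alpha,\beta,\Pi)\sim\frac{|\log\alpha|}{I_i},\qquad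 \mathrm E_A[\tilde T_j]\sim\mathcal L'_{j,A}(\alpha,\beta,\Pi)\sim\frac{|\log\beta|}{J_j}.$$ Moreover, the thresholds $a=|\log\alpha|+\log\max_{A\in\Pi}|A^c|$, $b=|\log\beta|+\log\max_{A\in\Pi}|A|$ satisfy these requirements. -/

import Mathlib

open MeasureTheory Filter Topology
open scoped ENNReal

namespace MultiTest

/-- The `σ`-algebra on a sequence space generated by the first `n` observations. The observation
made at time `t = 1, 2, …` is the coordinate with index `t - 1`. -/
@[reducible] def streamSigma (S : Type*) [MeasurableSpace S] (n : ℕ) : MeasurableSpace (ℕ → S) :=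
  MeasurableSpace.comap (fun (x : ℕ → S) (i : Fin n) => x i) MeasurableSpace.pi

theorem streamSigma_le (S : Type*) [MeasurableSpace S] (n : ℕ) :
    streamSigma S n ≤ (MeasurableSpace.pi : MeasurableSpace (ℕ → S)) :=
  Measurable.comap_le (measurable_pi_lambda _ fun i => measurable_pi_apply (i : ℕ))

/-- The log-likelihood ratio `log (dP₁/dP₀)` of the restrictions of `P₁` and `P₀` to the
`σ`-algebra of the first `n` observations of a stream. -/
noncomputable def lam {S : Type*} [MeasurableSpace S] (P₀ P₁ : Measure (ℕ → S)) (n : ℕ)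
    (x : ℕ → S) : ℝ :=
  llr (P₁.trim (streamSigma_le S n)) (P₀.trim (streamSigma_le S n)) x

/-- `P₀` and `P₁` are mutually absolutely continuous on the first `n` observations, for all `n`
(for `n = 0` this is automatic for probability measures). -/
def LocallyEquivalent {S : Type*} [MeasurableSpace S] (P₀ P₁ : Measure (ℕ → S)) : Prop :=
  ∀ n : ℕ,
    P₁.trim (streamSigma_le S n) ≪ P₀.trim (streamSigma_le S n) ∧
    P₀.trim (streamSigma_le S n) ≪ P₁.trim (streamSigma_le S n)

/-- Almost surely, `limsup λ(n)/n ≤ I` under `P₁` and `limsup (-λ(n))/n ≤ J` under `P₀`. The upper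
limits are taken in `[-∞, ∞]`. -/
def LimsupBound {S : Type*} [MeasurableSpace S] (P₀ P₁ : Measure (ℕ → S)) (I J : ℝ) : Prop :=
  (∀ᵐ x ∂P₁, limsup (fun n : ℕ => ((lam P₀ P₁ n x / n : ℝ) : EReal)) atTop ≤ (I : EReal)) ∧
  (∀ᵐ x ∂P₀, limsup (fun n : ℕ => ((-lam P₀ P₁ n x / n : ℝ) : EReal)) atTop ≤ (J : EReal))

/-- One-sided complete convergence of `λ(n)/n` to `I` under `P₁` and of `-λ(n)/n` to `J` under
`P₀`, both from below. -/
def CompleteLowerConvergence {S : Type*} [MeasurableSpace S] (P₀ P₁ : Measure (ℕ → S))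
    (I J : ℝ) : Prop :=
  (∀ ε : ℝ, 0 < ε →
    ∑' n : ℕ, P₁ {x | lam P₀ P₁ (n + 1) x / ((n + 1 : ℕ) : ℝ) ≤ I - ε} < ∞) ∧
  (∀ ε : ℝ, 0 < ε →
    ∑' n : ℕ, P₀ {x | -lam P₀ P₁ (n + 1) x / ((n + 1 : ℕ) : ℝ) ≤ J - ε} < ∞)

/-- The space of joint trajectories of the `K` streams; stream `k` takes values in `E k`. -/
abbrev Paths {K : ℕ} (E : Fin K → Type*) : Type _ := ∀ k : Fin K, ℕ → E k

section Streams

variable {K : ℕ} {E : Fin K → Type*} [∀ k, MeasurableSpace (E k)]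

variable (E) in
/-- `𝓕ₖ(n)`: generated by the first `n` observations of stream `k`. -/
@[reducible] def localSigma (k : Fin K) (n : ℕ) : MeasurableSpace (Paths E) :=
  MeasurableSpace.comap (fun ω : Paths E => ω k) (streamSigma (E k) n)

variable (E) in
/-- `𝓕(n)`: generated by the first `n` observations of all streams. -/
@[reducible] def globalSigma (n : ℕ) : MeasurableSpace (Paths E) :=
  ⨆ k : Fin K, localSigma E k n

/-- The joint law of the streams when the set of signals is `A`: the streams are independent, with
law `P₁ k` for `k ∈ A` and `P₀ k` for `k ∉ A`. -/
noncomputable def jointLaw (P₀ P₁ : ∀ k, Measure (ℕ → E k)) (A : Finset (Fin K)) :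
    Measure (Paths E) :=
  Measure.pi fun k => if k ∈ A then P₁ k else P₀ k

variable (E) in
/-- A vector of decision times (with values in `ℕ ∪ {∞}`) and a vector of decisions, where
`D k ω = true` means that stream `k` is identified as a signal. -/
structure Procedure where
  T : Fin K → Paths E → ℕ∞
  D : Fin K → Paths E → Bool

variable (E) in
/-- `Δ`: sequential multiple testing procedures. -/
def sequentialProcedures : Set (Procedure E) :=
  {χ | ∀ k : Fin K, (∀ ω, 1 ≤ χ.T k ω) ∧ ∀ n : ℕ, 1 ≤ n →
    MeasurableSet[globalSigma E n] {ω | χ.T k ω = n} ∧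
    ∀ i : Bool, MeasurableSet[globalSigma E n] {ω | χ.T k ω = n ∧ χ.D k ω = i}}

variable (E) in
/-- `Δ'`: decentralized procedures. -/
def decentralizedProcedures : Set (Procedure E) :=
  {χ | ∀ k : Fin K, (∀ ω, 1 ≤ χ.T k ω) ∧ ∀ n : ℕ, 1 ≤ n →
    MeasurableSet[localSigma E k n] {ω | χ.T k ω = n} ∧
    ∀ i : Bool, MeasurableSet[localSigma E k n] {ω | χ.T k ω = n ∧ χ.D k ω = i}}

/-- Type-I familywise error rate when the set of signals is `A`. -/
noncomputable def FWE1 (P₀ P₁ : ∀ k, Measure (ℕ → E k)) (A : Finset (Fin K))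
    (χ : Procedure E) : ℝ≥0∞ :=
  jointLaw P₀ P₁ A {ω | ∃ j, j ∉ A ∧ χ.D j ω = true}

/-- Type-II familywise error rate when the set of signals is `A`. -/
noncomputable def FWE2 (P₀ P₁ : ∀ k, Measure (ℕ → E k)) (A : Finset (Fin K))
    (χ : Procedure E) : ℝ≥0∞ :=
  jointLaw P₀ P₁ A {ω | ∃ i, i ∈ A ∧ χ.D i ω = false}

/-- `Δ(α, β, 𝒜)`: sequential multiple testing procedures that, under every signal configuration in
the class `𝒜`, terminate almost surely in every stream and have familywise error rates at most
`α` (type I) and `β` (type II). -/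
def controlledProcedures (P₀ P₁ : ∀ k, Measure (ℕ → E k)) (𝒜 : Finset (Finset (Fin K)))
    (α β : ℝ) : Set (Procedure E) :=
  {χ | χ ∈ sequentialProcedures E ∧ ∀ A ∈ 𝒜,
    (∀ k, ∀ᵐ ω ∂(jointLaw P₀ P₁ A), χ.T k ω < ⊤) ∧
    FWE1 P₀ P₁ A χ ≤ ENNReal.ofReal α ∧ FWE2 P₀ P₁ A χ ≤ ENNReal.ofReal β}

/-- Expected decision time in stream `k` when the set of signals is `A`. -/
noncomputable def expectedTime (P₀ P₁ : ∀ k, Measure (ℕ → E k)) (A : Finset (Fin K))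
    (χ : Procedure E) (k : Fin K) : ℝ≥0∞ :=
  ∫⁻ ω, (χ.T k ω : ℝ≥0∞) ∂(jointLaw P₀ P₁ A)

/-- `𝓛'_{k,A}(α, β, 𝒜)`: the smallest expected decision time in stream `k`, when the set of signals
is `A`, over the decentralized procedures in `Δ(α, β, 𝒜)` (`∞` if there are none). -/
noncomputable def optDecentralized (P₀ P₁ : ∀ k, Measure (ℕ → E k))
    (𝒜 : Finset (Finset (Fin K))) (A : Finset (Fin K)) (k : Fin K) (α β : ℝ) : ℝ≥0∞ :=
  ⨅ χ ∈ decentralizedProcedures E ∩ controlledProcedures P₀ P₁ 𝒜 α β, expectedTime P₀ P₁ A χ k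

open Classical in
/-- The parallel SPRT with thresholds `a, b`. In stream `k` it stops at the first `n ≥ 1` with
`λₖ(n) ∉ (-b, a)` (at `∞` if there is none), and identifies the stream as a signal if and only if
it has stopped with `λₖ ≥ a`. -/
noncomputable def parallelSPRT (P₀ P₁ : ∀ k, Measure (ℕ → E k)) (a b : ℝ) : Procedure E where
  T k ω := ⨅ (n : ℕ) (_ : 1 ≤ n ∧ lam (P₀ k) (P₁ k) n (ω k) ∉ Set.Ioo (-b) a), (n : ℕ∞)
  D k ω := decide (∃ n : ℕ,
    (⨅ (m : ℕ) (_ : 1 ≤ m ∧ lam (P₀ k) (P₁ k) m (ω k) ∉ Set.Ioo (-b) a), (m : ℕ∞)) = n ∧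
    a ≤ lam (P₀ k) (P₁ k) n (ω k))

/-- Thresholds `a, b`, as functions of `α, β`, are positive, put the parallel SPRT in
`Δ(α, β, 𝒜)` for all `α, β ∈ (0, 1)`, and satisfy `a ∼ |log α|`, `b ∼ |log β|` as `α, β → 0`. -/
def Calibrated (P₀ P₁ : ∀ k, Measure (ℕ → E k)) (𝒜 : Finset (Finset (Fin K)))
    (a b : ℝ → ℝ → ℝ) : Prop :=
  (∀ α ∈ Set.Ioo (0 : ℝ) 1, ∀ β ∈ Set.Ioo (0 : ℝ) 1,
    0 < a α β ∧ 0 < b α β ∧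
    parallelSPRT P₀ P₁ (a α β) (b α β) ∈ controlledProcedures P₀ P₁ 𝒜 α β) ∧
  Tendsto (fun p : ℝ × ℝ => a p.1 p.2 / |Real.log p.1|) (𝓝[>] 0 ×ˢ 𝓝[>] 0) (𝓝 1) ∧
  Tendsto (fun p : ℝ × ℝ => b p.1 p.2 / |Real.log p.2|) (𝓝[>] 0 ×ˢ 𝓝[>] 0) (𝓝 1)

end Streams

/-- `u ∼ v` as `α, β ↓ 0` (jointly, with no relation between `α` and `β`): the ratio tends to `1`.
Since `x / 0` and `x / ∞` are `0` or `∞` in `[0, ∞]`, this forces `u` and `v` to be positive and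
finite for all small `α, β`. -/
def AsympEq (u v : ℝ → ℝ → ℝ≥0∞) : Prop :=
  Tendsto (fun p : ℝ × ℝ => u p.1 p.2 / v p.1 p.2) (𝓝[>] 0 ×ˢ 𝓝[>] 0) (𝓝 1)

end MultiTest

open MultiTest

/-!
In stream `k` a decentralized procedure is a sequential test of `P₁ k` against `P₀ k` based on that
stream alone, with error probabilities at most `α` and `β` because some configuration of the class
contains `k` and some other does not. By symmetry (replace `λ` by `-λ`) let `k` be a signal.

Lower bound. Take `q < 1` and `m ≈ q |log α| / I`. To stop by time `m`, a test
must either wrongly declare noise (probability at most `β`), or see `λ` exceed `I' m` for some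
`I' > I` by time `m` (negligible, by the bound on the upper limit of `λ(n) / n`), or stop with
`λ ≤ I' m` and declare a signal. The last event has `P₁`-probability at most `exp (I' m)` times its
`P₀`-probability, which is at most `α`; as `I' m < |log α|` for `I'` close to `I`, this is also
negligible. Hence the test exceeds `m` with probability tending to one.

Upper bound. Before the SPRT stops, `λ` is below `a`; so after time `a / I'`, with `I' < I`, each
further observation is charged to an `n` with `λ(n) / n ≤ I'`, and the expected number of such `n`
is finite. Thus the expected time is at most `a / I' + O(1)`.

The explicit thresholds come from Wald's bounds `exp (-a)` and `exp (-b)` on the error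
probabilities in one stream, summed over the streams.
-/

namespace MultiTest

section LikelihoodRatio

variable {Ω Ω' : Type*} [mΩ : MeasurableSpace Ω] [mΩ' : MeasurableSpace Ω'] {Q P : Measure Ω}
  {𝓕 : Filtration ℕ mΩ} {ℓ : ℕ → Ω → ℝ}

/-- The process `ℓ` is a version of the log-likelihood ratio of `Q` against `P` along the
filtration `𝓕`: it is adapted, and `exp (ℓ n)` is a density of `Q` with respect to `P` on `𝓕 n`. -/
structure IsLogLikelihood (Q P : Measure Ω) (𝓕 : Filtration ℕ mΩ) (ℓ : ℕ → Ω → ℝ) : Prop where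
  adapted : Adapted 𝓕 ℓ
  measure_eq : ∀ (n : ℕ) (F : Set Ω), MeasurableSet[𝓕 n] F →
    Q F = ∫⁻ ω in F, ENNReal.ofReal (Real.exp (ℓ n ω)) ∂P

namespace IsLogLikelihood

theorem measurable (h : IsLogLikelihood Q P 𝓕 ℓ) (n : ℕ) : Measurable (ℓ n) :=
  (h.adapted n).mono (𝓕.le n) le_rfl

theorem trim_eq_withDensity (h : IsLogLikelihood Q P 𝓕 ℓ) (n : ℕ) :
    Q.trim (𝓕.le n) =
      (P.trim (𝓕.le n)).withDensity fun ω => ENNReal.ofReal (Real.exp (ℓ n ω)) := by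
  refine @Measure.ext _ (𝓕 n) _ _ fun F hF => ?_
  have hℓ := h.adapted n
  rw [trim_measurableSet_eq _ hF, withDensity_apply _ hF, h.measure_eq n F hF,
    setLIntegral_trim _ (by fun_prop) hF]

theorem neg (h : IsLogLikelihood Q P 𝓕 ℓ) : IsLogLikelihood P Q 𝓕 fun n ω => -ℓ n ω where
  adapted n := (h.adapted n).neg
  measure_eq n F hF := by
    have hℓ := h.adapted n
    have hinv : P.trim (𝓕.le n) = (Q.trim (𝓕.le n)).withDensity
        (fun ω => ENNReal.ofReal (Real.exp (ℓ n ω)))⁻¹ := by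
      rw [h.trim_eq_withDensity n]
      exact (withDensity_inv_same (by fun_prop)
        (.of_forall fun _ => (ENNReal.ofReal_pos.2 (Real.exp_pos _)).ne')
        (.of_forall fun _ => ENNReal.ofReal_ne_top)).symm
    rw [← trim_measurableSet_eq (𝓕.le n) hF, hinv, withDensity_apply _ hF,
      setLIntegral_trim _ (by fun_prop) hF]
    simp only [Pi.inv_apply, Real.exp_neg, ENNReal.ofReal_inv_of_pos (Real.exp_pos _)]

theorem measure_inter_le (h : IsLogLikelihood Q P 𝓕 ℓ) (n : ℕ) {F : Set Ω}
    (hF : MeasurableSet[𝓕 n] F) (c : ℝ) :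
    Q (F ∩ {ω | ℓ n ω ≤ c}) ≤ ENNReal.ofReal (Real.exp c) * P F := by
  have hFc : MeasurableSet[𝓕 n] (F ∩ {ω | ℓ n ω ≤ c}) := hF.inter (h.adapted n measurableSet_Iic)
  calc Q (F ∩ {ω | ℓ n ω ≤ c})
      = ∫⁻ ω in F ∩ {ω | ℓ n ω ≤ c}, ENNReal.ofReal (Real.exp (ℓ n ω)) ∂P := h.measure_eq n _ hFc
    _ ≤ ∫⁻ _ in F ∩ {ω | ℓ n ω ≤ c}, ENNReal.ofReal (Real.exp c) ∂P :=
        setLIntegral_mono measurable_const fun ω hω =>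
          ENNReal.ofReal_le_ofReal (Real.exp_le_exp.2 hω.2)
    _ ≤ ENNReal.ofReal (Real.exp c) * P F := by
        rw [setLIntegral_const]
        gcongr
        exact Set.inter_subset_left

/-- Wald's likelihood ratio bound: on the event that `ℓ ≤ c` at the random time `T`, the measure
`Q` is at most `exp c` times `P`. -/
theorem measure_exists_eq_inter_le (h : IsLogLikelihood Q P 𝓕 ℓ) {T : Ω → ℕ∞} {F : Set Ω}
    (hF : ∀ n : ℕ, MeasurableSet[𝓕 n] ({ω | T ω = n} ∩ F)) (c : ℝ) :
    Q ({ω | ∃ n : ℕ, T ω = n ∧ ℓ n ω ≤ c} ∩ F) ≤ ENNReal.ofReal (Real.exp c) * P F := by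
  have hcover : {ω | ∃ n : ℕ, T ω = n ∧ ℓ n ω ≤ c} ∩ F ⊆
      ⋃ n : ℕ, ({ω | T ω = n} ∩ F) ∩ {ω | ℓ n ω ≤ c} :=
    fun ω ⟨⟨n, hn, hc⟩, hω⟩ => Set.mem_iUnion.2 ⟨n, ⟨hn, hω⟩, hc⟩
  have hdisj : Pairwise (Function.onFun Disjoint fun n : ℕ => {ω | T ω = n} ∩ F) :=
    fun n n' hne => Set.disjoint_left.2 fun ω hn hn' =>
      hne (Nat.cast_injective (hn.1.symm.trans hn'.1))
  calc Q ({ω | ∃ n : ℕ, T ω = n ∧ ℓ n ω ≤ c} ∩ F)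
      ≤ ∑' n : ℕ, Q (({ω | T ω = n} ∩ F) ∩ {ω | ℓ n ω ≤ c}) :=
        (measure_mono hcover).trans (measure_iUnion_le _)
    _ ≤ ∑' n : ℕ, ENNReal.ofReal (Real.exp c) * P ({ω | T ω = n} ∩ F) :=
        ENNReal.tsum_le_tsum fun n => h.measure_inter_le n (hF n) c
    _ = ENNReal.ofReal (Real.exp c) * P (⋃ n : ℕ, {ω | T ω = n} ∩ F) := by
        rw [ENNReal.tsum_mul_left, measure_iUnion hdisj fun n => 𝓕.le n _ (hF n)]
    _ ≤ ENNReal.ofReal (Real.exp c) * P F := by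
        gcongr
        exact Set.iUnion_subset fun n => Set.inter_subset_right

end IsLogLikelihood

/-- The pullback of a filtration along a measurable map. -/
def filtrationComap (𝓕 : Filtration ℕ mΩ) {f : Ω' → Ω} (hf : Measurable f) :
    Filtration ℕ mΩ' where
  seq n := (𝓕 n).comap f
  mono' _ _ hmn := MeasurableSpace.comap_mono (𝓕.mono hmn)
  le' n := (MeasurableSpace.comap_mono (𝓕.le n)).trans hf.comap_le

theorem IsLogLikelihood.comap (h : IsLogLikelihood Q P 𝓕 ℓ) {Q' P' : Measure Ω'} {f : Ω' → Ω}
    (hQ : MeasurePreserving f Q' Q) (hP : MeasurePreserving f P' P) :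
    IsLogLikelihood Q' P' (filtrationComap 𝓕 hQ.measurable) fun n ω => ℓ n (f ω) where
  adapted n := (h.adapted n).comp (comap_measurable f)
  measure_eq n F := by
    rintro ⟨G, hG, rfl⟩
    have hℓ := h.measurable n
    rw [hQ.measure_preimage (𝓕.le n _ hG).nullMeasurableSet, h.measure_eq n G hG,
      hP.setLIntegral_comp_preimage (f := fun x => ENNReal.ofReal (Real.exp (ℓ n x)))
        (𝓕.le n _ hG) (by fun_prop)]

end LikelihoodRatio

section ExpectedTime

variable {Ω : Type*} [mΩ : MeasurableSpace Ω] {Q P : Measure Ω} {𝓕 : Filtration ℕ mΩ}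
  {ℓ : ℕ → Ω → ℝ} {T : Ω → ℕ∞}

theorem IsLogLikelihood.measure_le_natCast_le (h : IsLogLikelihood Q P 𝓕 ℓ) {F : Set Ω}
    (hF : ∀ n : ℕ, MeasurableSet[𝓕 n] ({ω | T ω = n} ∩ F)) (m : ℕ) (c : ℝ) :
    Q {ω | T ω ≤ m} ≤
      Q {ω | ∃ n ≤ m, c < ℓ n ω} + ENNReal.ofReal (Real.exp c) * P F + Q Fᶜ := by
  have hcover : {ω | T ω ≤ m} ⊆
      ({ω | ∃ n ≤ m, c < ℓ n ω} ∪ ({ω | ∃ n : ℕ, T ω = n ∧ ℓ n ω ≤ c} ∩ F)) ∪ Fᶜ := by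
    intro ω hω
    obtain ⟨n, hn, hnm⟩ := ENat.le_natCast_iff.1 hω
    by_cases hωF : ω ∈ F
    · rcases le_or_gt (ℓ n ω) c with hc | hc
      · exact .inl (.inr ⟨⟨n, hn, hc⟩, hωF⟩)
      · exact .inl (.inl ⟨n, hnm, hc⟩)
    · exact .inr hωF
  calc Q {ω | T ω ≤ m}
      ≤ Q {ω | ∃ n ≤ m, c < ℓ n ω} + Q ({ω | ∃ n : ℕ, T ω = n ∧ ℓ n ω ≤ c} ∩ F) + Q Fᶜ :=
        (measure_mono hcover).trans
          ((measure_union_le _ _).trans (add_le_add_left (measure_union_le _ _) _))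
    _ ≤ Q {ω | ∃ n ≤ m, c < ℓ n ω} + ENNReal.ofReal (Real.exp c) * P F + Q Fᶜ := by
        gcongr
        exact h.measure_exists_eq_inter_le hF c

theorem natCast_mul_one_sub_le_lintegral [IsProbabilityMeasure Q] (hT : Measurable T) (m : ℕ) :
    (m : ℝ≥0∞) * (1 - Q {ω | T ω ≤ m}) ≤ ∫⁻ ω, (T ω : ℝ≥0∞) ∂Q := by
  have hcast : Measurable fun ω => (T ω : ℝ≥0∞) := measurable_from_top.comp hT
  have hearly : MeasurableSet {ω | T ω ≤ m} := hT (.of_discrete (s := Set.Iic (m : ℕ∞)))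
  have hlate : {ω | T ω ≤ m}ᶜ ⊆ {ω | (m : ℝ≥0∞) ≤ T ω} := fun ω hω => by
    simpa using ENat.toENNReal_le.2 (lt_of_not_ge fun h => hω h).le
  calc (m : ℝ≥0∞) * (1 - Q {ω | T ω ≤ m})
      = m * Q {ω | T ω ≤ m}ᶜ := by rw [prob_compl_eq_one_sub hearly]
    _ ≤ m * Q {ω | (m : ℝ≥0∞) ≤ T ω} := by gcongr
    _ ≤ ∫⁻ ω, (T ω : ℝ≥0∞) ∂Q := mul_meas_ge_le_lintegral hcast _

theorem tendsto_measure_exists_le_lt [IsFiniteMeasure Q] (hℓ : ∀ n, Measurable (ℓ n)) {I I' : ℝ}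
    (hlim : ∀ᵐ ω ∂Q, limsup (fun n : ℕ => ((ℓ n ω / n : ℝ) : EReal)) atTop ≤ (I : EReal))
    (hI : I < I') (hI' : 0 < I') :
    Tendsto (fun m : ℕ => Q {ω | ∃ n ≤ m, I' * m < ℓ n ω}) atTop (𝓝 0) := by
  rw [← measure_empty (μ := Q)]
  refine tendsto_measure_of_ae_tendsto_indicator_of_isFiniteMeasure atTop MeasurableSet.empty
    (fun m => by measurability) ?_
  filter_upwards [hlim] with ω hω
  have hratio : ∀ᶠ n : ℕ in atTop, ((ℓ n ω / n : ℝ) : EReal) < (I' : EReal) :=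
    eventually_lt_of_limsup_lt (hω.trans_lt (EReal.coe_lt_coe_iff.2 hI))
  obtain ⟨N, hN⟩ := eventually_atTop.1 (hratio.and (eventually_gt_atTop 0))
  have hlevel : Tendsto (fun m : ℕ => I' * (m : ℝ)) atTop atTop :=
    tendsto_natCast_atTop_atTop.const_mul_atTop hI'
  have hinitial : ∀ᶠ m : ℕ in atTop, ∀ n ∈ Finset.range N, ℓ n ω ≤ I' * m :=
    (Finset.eventually_all _).2 fun n _ => hlevel.eventually_ge_atTop _
  filter_upwards [hinitial] with m hm
  simp only [Set.mem_empty_iff_false, iff_false, not_exists, not_and, not_lt]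
  intro n hnm
  rcases lt_or_ge n N with hnN | hNn
  · exact hm n (Finset.mem_range.2 hnN)
  · obtain ⟨hlt, hn⟩ := hN n hNn
    calc ℓ n ω ≤ I' * n := (div_le_iff₀ (Nat.cast_pos.2 hn)).1 (EReal.coe_lt_coe_iff.1 hlt).le
      _ ≤ I' * m := by gcongr

theorem le_add_encard_of_forall_mem {t : ℕ∞} {N : ℕ} {s : Set ℕ}
    (h : ∀ n ≥ N, ((n + 1 : ℕ) : ℕ∞) < t → n ∈ s) : t ≤ (N + 1 : ℕ) + s.encard := by
  refine ENat.forall_natCast_le_iff_le.1 fun M hM => ?_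
  have hsub : (Finset.Ico N (M - 1) : Set ℕ) ⊆ s := fun n hn => by
    rw [Finset.mem_coe, Finset.mem_Ico] at hn
    exact h n hn.1 ((Nat.cast_lt.2 (by omega)).trans_le hM)
  calc (M : ℕ∞) ≤ (N + 1 : ℕ) + ((M - 1 - N : ℕ) : ℕ∞) := by exact_mod_cast (by omega)
    _ = (N + 1 : ℕ) + (Finset.Ico N (M - 1) : Set ℕ).encard := by
        rw [Set.encard_coe_eq_coe_finsetCard, Nat.card_Ico]
    _ ≤ (N + 1 : ℕ) + s.encard := by gcongr

theorem lintegral_encard_setOf {G : ℕ → Set Ω} (hG : ∀ n, MeasurableSet (G n)) :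
    ∫⁻ ω, ({n | ω ∈ G n}.encard : ℝ≥0∞) ∂Q = ∑' n, Q (G n) := by
  have hcount : ∀ ω, ({n | ω ∈ G n}.encard : ℝ≥0∞) = ∑' n, (G n).indicator 1 ω := fun ω => by
    rw [← ENNReal.tsum_set_one, tsum_subtype {n | ω ∈ G n} fun _ => (1 : ℝ≥0∞)]
    rfl
  have hmeas : ∀ n, AEMeasurable ((G n).indicator (1 : Ω → ℝ≥0∞)) Q := fun n =>
    (measurable_one.indicator (hG n)).aemeasurable
  simp only [hcount, lintegral_tsum hmeas, lintegral_indicator_one (hG _)]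

theorem lintegral_le_of_forall_lt [IsProbabilityMeasure Q] (hℓ : ∀ n, Measurable (ℓ n)) {a : ℝ}
    (hT : ∀ ω (n : ℕ), 1 ≤ n → (n : ℕ∞) < T ω → ℓ n ω < a) {I' : ℝ} (hI' : 0 < I') (ha : 0 ≤ a) :
    ∫⁻ ω, (T ω : ℝ≥0∞) ∂Q ≤ ENNReal.ofReal (a / I' + 2) +
      ∑' n : ℕ, Q {ω | ℓ (n + 1) ω / ((n + 1 : ℕ) : ℝ) ≤ I'} := by
  set G : ℕ → Set Ω := fun n => {ω | ℓ (n + 1) ω / ((n + 1 : ℕ) : ℝ) ≤ I'}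
  have hG : ∀ n, MeasurableSet (G n) := fun n =>
    measurableSet_le ((hℓ _).div_const _) measurable_const
  have hslow : ∀ ω, ∀ n ≥ ⌈a / I'⌉₊, ((n + 1 : ℕ) : ℕ∞) < T ω → n ∈ {n | ω ∈ G n} := by
    intro ω n hn hnT
    have hn' : a / I' ≤ (n + 1 : ℕ) := (Nat.ceil_le.1 hn).trans (by exact_mod_cast n.le_succ)
    change ℓ (n + 1) ω / ((n + 1 : ℕ) : ℝ) ≤ I'
    rw [div_le_iff₀ (by positivity)]
    calc ℓ (n + 1) ω ≤ a := (hT ω (n + 1) n.succ_pos hnT).le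
      _ ≤ I' * (n + 1 : ℕ) := by rwa [div_le_iff₀' hI'] at hn'
  calc ∫⁻ ω, (T ω : ℝ≥0∞) ∂Q
      ≤ ∫⁻ ω, ((⌈a / I'⌉₊ + 1 : ℕ) : ℝ≥0∞) + {n | ω ∈ G n}.encard ∂Q :=
        lintegral_mono fun ω => by
          simpa using ENat.toENNReal_le.2 (le_add_encard_of_forall_mem (hslow ω))
    _ = ((⌈a / I'⌉₊ + 1 : ℕ) : ℝ≥0∞) + ∑' n, Q (G n) := by
        rw [lintegral_add_left measurable_const, lintegral_const, measure_univ, mul_one,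
          lintegral_encard_setOf hG]
    _ ≤ ENNReal.ofReal (a / I' + 2) + ∑' n, Q (G n) := by
        gcongr
        rw [← ENNReal.ofReal_natCast]
        refine ENNReal.ofReal_le_ofReal ?_
        push_cast
        linarith [Nat.ceil_lt_add_one (div_nonneg ha hI'.le)]

theorem ae_exists_le_of_tsum_ne_top {I' : ℝ} (hI' : 0 < I')
    (h : ∑' n : ℕ, Q {ω | ℓ (n + 1) ω / ((n + 1 : ℕ) : ℝ) ≤ I'} ≠ ∞) (a : ℝ) :
    ∀ᵐ ω ∂Q, ∃ n, 1 ≤ n ∧ a ≤ ℓ n ω := by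
  filter_upwards [ae_eventually_notMem h] with ω hω
  have hlevel : Tendsto (fun n : ℕ => I' * ((n + 1 : ℕ) : ℝ)) atTop atTop :=
    (tendsto_natCast_atTop_atTop.comp (tendsto_add_atTop_nat 1)).const_mul_atTop hI'
  obtain ⟨n, hn, ha⟩ := (hω.and (hlevel.eventually_ge_atTop a)).exists
  exact ⟨n + 1, n.succ_pos, ha.trans ((le_div_iff₀ (by positivity)).1 (not_le.1 hn).le)⟩

end ExpectedTime

section Asymptotics

variable {ι : Type*} {l : Filter ι} {x y : ι → ℝ}

theorem tendsto_abs_log_atTop (hx : Tendsto x l (𝓝[>] 0)) :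
    Tendsto (fun p => |Real.log (x p)|) l atTop :=
  tendsto_abs_atBot_atTop.comp (Real.tendsto_log_nhdsGT_zero.comp hx)

theorem tendsto_abs_log_add_div (hx : Tendsto x l (𝓝[>] 0)) (c : ℝ) :
    Tendsto (fun p => (|Real.log (x p)| + c) / |Real.log (x p)|) l (𝓝 1) := by
  have hlog := tendsto_abs_log_atTop hx
  have hlim : Tendsto (fun p => 1 + c / |Real.log (x p)|) l (𝓝 1) := by
    simpa using tendsto_const_nhds.add (hlog.const_div_atTop c)
  refine hlim.congr' ((hlog.eventually_gt_atTop 0).mono fun p hp => ?_)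
  simp only [add_div, div_self hp.ne']

theorem tendsto_exp_mul_floor_mul_self {I I' q : ℝ} (hx : Tendsto x l (𝓝[>] 0)) (hI : 0 < I)
    (hI' : 0 ≤ I') (hq : 0 ≤ q) (hlt : I' * q < I) :
    Tendsto (fun p => Real.exp (I' * ⌊q * (|Real.log (x p)| / I)⌋₊) * x p) l (𝓝 0) := by
  have hdecay : Tendsto (fun p => Real.exp (-((1 - I' * q / I) * |Real.log (x p)|))) l (𝓝 0) :=
    Real.tendsto_exp_neg_atTop_nhds_zero.comp
      ((tendsto_abs_log_atTop hx).const_mul_atTop (sub_pos.2 ((div_lt_one hI).2 hlt)))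
  have hx01 : ∀ᶠ p in l, x p ∈ Set.Ioo (0 : ℝ) 1 := hx (Ioo_mem_nhdsGT one_pos)
  refine squeeze_zero' (hx01.mono fun p hp => mul_nonneg (Real.exp_pos _).le hp.1.le)
    (hx01.mono fun p hp => ?_) hdecay
  have hexp : x p = Real.exp (-|Real.log (x p)|) := by
    rw [abs_of_neg (Real.log_neg hp.1 hp.2), neg_neg, Real.exp_log hp.1]
  calc Real.exp (I' * ⌊q * (|Real.log (x p)| / I)⌋₊) * x p
      = Real.exp (I' * ⌊q * (|Real.log (x p)| / I)⌋₊ - |Real.log (x p)|) := by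
        rw [sub_eq_add_neg, Real.exp_add, ← hexp]
    _ ≤ Real.exp (I' * (q * (|Real.log (x p)| / I)) - |Real.log (x p)|) := by
        gcongr
        exact Nat.floor_le (by positivity)
    _ = Real.exp (-((1 - I' * q / I) * |Real.log (x p)|)) := by ring_nf

theorem tendsto_div_ofReal_one {w : ι → ℝ≥0∞} {r : ι → ℝ} (hr : ∀ᶠ p in l, 0 < r p)
    (hlower : ∀ q ∈ Set.Ioo (0 : ℝ) 1, ∀ᶠ p in l, ENNReal.ofReal (q * r p) ≤ w p)
    (hupper : ∀ s : ℝ, 1 < s → ∀ᶠ p in l, w p ≤ ENNReal.ofReal (s * r p)) :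
    Tendsto (fun p => w p / ENNReal.ofReal (r p)) l (𝓝 1) := by
  refine tendsto_order.2 ⟨fun c hc => ?_, fun c hc => ?_⟩
  · obtain ⟨q, hcq, hq⟩ := ENNReal.lt_iff_exists_nnreal_btwn.1 hc
    have hq0 : (0 : ℝ) < q := by exact_mod_cast pos_of_gt hcq
    filter_upwards [hr, hlower q ⟨hq0, by exact_mod_cast hq⟩] with p hp hle
    refine hcq.trans_le ((ENNReal.le_div_iff_mul_le (.inl (ENNReal.ofReal_pos.2 hp).ne')
      (.inl ENNReal.ofReal_ne_top)).2 ?_)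
    rwa [ENNReal.ofReal_mul q.coe_nonneg, ENNReal.ofReal_coe_nnreal] at hle
  · obtain ⟨s, hs, hsc⟩ := ENNReal.lt_iff_exists_nnreal_btwn.1 hc
    filter_upwards [hupper s (by exact_mod_cast hs)] with p hle
    refine (ENNReal.div_le_of_le_mul ?_).trans_lt hsc
    rwa [ENNReal.ofReal_mul s.coe_nonneg, ENNReal.ofReal_coe_nnreal] at hle

theorem tendsto_div_one_of_squeeze {u v : ι → ℝ≥0∞} {r : ι → ℝ} (hr : ∀ᶠ p in l, 0 < r p)
    (hlower : ∀ q ∈ Set.Ioo (0 : ℝ) 1, ∀ᶠ p in l, ENNReal.ofReal (q * r p) ≤ v p)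
    (hvu : ∀ᶠ p in l, v p ≤ u p)
    (hupper : ∀ s : ℝ, 1 < s → ∀ᶠ p in l, u p ≤ ENNReal.ofReal (s * r p)) :
    Tendsto (fun p => u p / v p) l (𝓝 1) ∧
      Tendsto (fun p => v p / ENNReal.ofReal (r p)) l (𝓝 1) ∧
      Tendsto (fun p => u p / ENNReal.ofReal (r p)) l (𝓝 1) := by
  have hv : Tendsto (fun p => v p / ENNReal.ofReal (r p)) l (𝓝 1) :=
    tendsto_div_ofReal_one hr hlower fun s hs => by
      filter_upwards [hvu, hupper s hs] with p using le_trans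
  have hu : Tendsto (fun p => u p / ENNReal.ofReal (r p)) l (𝓝 1) :=
    tendsto_div_ofReal_one hr (fun q hq => by
      filter_upwards [hlower q hq, hvu] with p using le_trans) hupper
  have huv := ENNReal.Tendsto.div hu (.inl one_ne_zero) hv (.inl ENNReal.one_ne_top)
  rw [div_one] at huv
  refine ⟨huv.congr' (hr.mono fun p hp => ?_), hv, hu⟩
  rw [div_eq_mul_inv (u p), div_eq_mul_inv (v p), ENNReal.mul_div_mul_right _ _
    (ENNReal.inv_ne_zero.2 ENNReal.ofReal_ne_top)
    (ENNReal.inv_ne_top.2 (ENNReal.ofReal_pos.2 hp).ne')]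

variable {Ω : Type*} [mΩ : MeasurableSpace Ω] {Q P : Measure Ω} [IsProbabilityMeasure Q]
  {𝓕 : Filtration ℕ mΩ} {ℓ : ℕ → Ω → ℝ} {I : ℝ}

theorem IsLogLikelihood.eventually_forall_le_lintegral (h : IsLogLikelihood Q P 𝓕 ℓ) (hI : 0 < I)
    (hlim : ∀ᵐ ω ∂Q, limsup (fun n : ℕ => ((ℓ n ω / n : ℝ) : EReal)) atTop ≤ (I : EReal))
    (hx : Tendsto x l (𝓝[>] 0)) (hy : Tendsto y l (𝓝[>] 0)) {q : ℝ} (hq : q ∈ Set.Ioo (0 : ℝ) 1) :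
    ∀ᶠ p in l, ∀ (T : Ω → ℕ∞) (F : Set Ω), Measurable T →
      (∀ n : ℕ, MeasurableSet[𝓕 n] ({ω | T ω = n} ∩ F)) →
      P F ≤ ENNReal.ofReal (x p) → Q Fᶜ ≤ ENNReal.ofReal (y p) →
      ENNReal.ofReal (q * (|Real.log (x p)| / I)) ≤ ∫⁻ ω, (T ω : ℝ≥0∞) ∂Q := by
  obtain ⟨q', hqq', hq'⟩ := exists_between hq.2
  have hq'0 : 0 < q' := hq.1.trans hqq'
  obtain ⟨I', hII', hI'⟩ := exists_between ((lt_div_iff₀ hq'0).2 (mul_lt_of_lt_one_right hI hq'))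
  have hI'0 : 0 < I' := hI.trans hII'
  have hr : Tendsto (fun p => |Real.log (x p)| / I) l atTop :=
    (tendsto_abs_log_atTop hx).atTop_div_const hI
  set r : ι → ℝ := fun p => |Real.log (x p)| / I
  set m : ι → ℕ := fun p => ⌊q' * r p⌋₊
  set e : ι → ℝ≥0∞ := fun p => Q {ω | ∃ n ≤ m p, I' * m p < ℓ n ω} +
    ENNReal.ofReal (Real.exp (I' * m p)) * ENNReal.ofReal (x p) + ENNReal.ofReal (y p)
  have he : Tendsto e l (𝓝 0) := by
    have hearly := (tendsto_measure_exists_le_lt h.measurable hlim hII' hI'0).comp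
      (tendsto_nat_floor_atTop.comp (hr.const_mul_atTop hq'0))
    have herr := ENNReal.tendsto_ofReal
      (tendsto_exp_mul_floor_mul_self hx hI hI'0.le hq'0.le ((lt_div_iff₀ hq'0).1 hI'))
    have hmiss := ENNReal.tendsto_ofReal (hy.mono_right nhdsWithin_le_nhds)
    simpa [e, m, r, ENNReal.ofReal_mul, Real.exp_nonneg] using (hearly.add herr).add hmiss
  have hm : Tendsto (fun p => ENNReal.ofReal (m p / r p) * (1 - e p)) l
      (𝓝 (ENNReal.ofReal q')) := by
    have hfloor := (tendsto_nat_floor_mul_div_atTop hq'0.le).comp hr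
    simpa using ENNReal.Tendsto.mul (ENNReal.tendsto_ofReal hfloor) (.inr (by simp))
      (ENNReal.Tendsto.sub tendsto_const_nhds he (.inl ENNReal.one_ne_top)) (.inr (by simp))
  filter_upwards [hm.eventually_const_le ((ENNReal.ofReal_lt_ofReal_iff hq'0).2 hqq'),
    hr.eventually_gt_atTop 0] with p hqm hrp T F hT hTF hPF hQF
  calc ENNReal.ofReal (q * r p)
      = ENNReal.ofReal (r p) * ENNReal.ofReal q := by rw [mul_comm, ENNReal.ofReal_mul hrp.le]
    _ ≤ ENNReal.ofReal (r p) * (ENNReal.ofReal (m p / r p) * (1 - e p)) := by gcongr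
    _ = m p * (1 - e p) := by
        rw [← mul_assoc, ← ENNReal.ofReal_mul hrp.le, mul_div_cancel₀ _ hrp.ne',
          ENNReal.ofReal_natCast]
    _ ≤ m p * (1 - Q {ω | T ω ≤ m p}) := by
        gcongr
        exact (h.measure_le_natCast_le hTF (m p) (I' * m p)).trans (by simp only [e]; gcongr)
    _ ≤ ∫⁻ ω, (T ω : ℝ≥0∞) ∂Q := natCast_mul_one_sub_le_lintegral hT (m p)

theorem eventually_lintegral_le (hℓ : ∀ n, Measurable (ℓ n)) (hI : 0 < I)
    (hsum : ∀ I' < I, ∑' n : ℕ, Q {ω | ℓ (n + 1) ω / ((n + 1 : ℕ) : ℝ) ≤ I'} ≠ ∞)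
    (hx : Tendsto x l (𝓝[>] 0)) {a : ι → ℝ}
    (ha : Tendsto (fun p => a p / |Real.log (x p)|) l (𝓝 1)) {T : ι → Ω → ℕ∞}
    (hT : ∀ p ω (n : ℕ), 1 ≤ n → (n : ℕ∞) < T p ω → ℓ n ω < a p) {s : ℝ} (hs : 1 < s) :
    ∀ᶠ p in l, ∫⁻ ω, (T p ω : ℝ≥0∞) ∂Q ≤ ENNReal.ofReal (s * (|Real.log (x p)| / I)) := by
  have hs0 : 0 < s := one_pos.trans hs
  obtain ⟨I', hI's, hI'I⟩ := exists_between (div_lt_self hI hs)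
  have hI' : 0 < I' := (div_pos hI hs0).trans hI's
  have hlog := tendsto_abs_log_atTop hx
  set C : ℝ≥0∞ := ∑' n : ℕ, Q {ω | ℓ (n + 1) ω / ((n + 1 : ℕ) : ℝ) ≤ I'}
  have hbound : Tendsto (fun p => (a p / I' + 2 + C.toReal) / (|Real.log (x p)| / I)) l
      (𝓝 (I / I')) := by
    have hlim := (ha.mul_const (I / I')).add
      ((hlog.atTop_div_const hI).const_div_atTop (2 + C.toReal))
    rw [one_mul, add_zero] at hlim
    refine hlim.congr' ((hlog.eventually_gt_atTop 0).mono fun p hp => ?_)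
    field_simp
    ring
  filter_upwards [hlog.eventually_gt_atTop 0, ha.eventually_const_lt one_pos,
    hbound.eventually_le_const ((div_lt_comm₀ hs0 hI').1 hI's)] with p hp hap hle
  have hap : 0 < a p := (div_pos_iff_of_pos_right hp).1 hap
  calc ∫⁻ ω, (T p ω : ℝ≥0∞) ∂Q
      ≤ ENNReal.ofReal (a p / I' + 2) + C := lintegral_le_of_forall_lt hℓ (hT p) hI' hap.le
    _ = ENNReal.ofReal (a p / I' + 2 + C.toReal) := by
        rw [ENNReal.ofReal_add (by positivity) ENNReal.toReal_nonneg,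
          ENNReal.ofReal_toReal (hsum I' hI'I)]
    _ ≤ ENNReal.ofReal (s * (|Real.log (x p)| / I)) :=
        ENNReal.ofReal_le_ofReal ((div_le_iff₀ (div_pos hp hI)).1 hle)

end Asymptotics

section Stream

variable {S : Type*} [MeasurableSpace S] {P₀ P₁ : Measure (ℕ → S)}

theorem streamSigma_mono (S : Type*) [MeasurableSpace S] : Monotone (streamSigma S) :=
  fun m n hmn => by
    have hrestrict : (fun (x : ℕ → S) (i : Fin m) => x i) =
        (fun (y : Fin n → S) (i : Fin m) => y (Fin.castLE hmn i)) ∘ fun x i => x i := rfl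
    unfold streamSigma
    rw [hrestrict, ← MeasurableSpace.comap_comp]
    exact MeasurableSpace.comap_mono (Measurable.comap_le (by fun_prop))

/-- The filtration generated by the successive observations of a stream. -/
def streamFiltration (S : Type*) [MeasurableSpace S] :
    Filtration ℕ (MeasurableSpace.pi : MeasurableSpace (ℕ → S)) where
  seq := streamSigma S
  mono' := streamSigma_mono S
  le' := streamSigma_le S

/-- The law of a stream that is a signal (`θ = true`) or noise (`θ = false`). -/
noncomputable def streamLaw (P₀ P₁ : Measure (ℕ → S)) (θ : Bool) : Measure (ℕ → S) :=
  bif θ then P₁ else P₀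

/-- The log-likelihood ratio in favour of the hypothesis `θ`: `λ` for signal (`θ = true`) and `-λ`
for noise (`θ = false`). It lets both kinds of stream be treated by the same argument. -/
noncomputable def evidence (P₀ P₁ : Measure (ℕ → S)) (θ : Bool) (n : ℕ) (x : ℕ → S) : ℝ :=
  bif θ then lam P₀ P₁ n x else -lam P₀ P₁ n x

theorem evidence_not (θ : Bool) (n : ℕ) (x : ℕ → S) :
    evidence P₀ P₁ (!θ) n x = -evidence P₀ P₁ θ n x := by
  cases θ <;> simp [evidence]

theorem adapted_lam : Adapted (streamFiltration S) (lam P₀ P₁) := fun n =>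
  @measurable_llr _ (streamSigma S n) _ _

theorem measurable_evidence (θ : Bool) (n : ℕ) : Measurable (evidence P₀ P₁ θ n) := by
  have hlam : Measurable (lam P₀ P₁ n) := (adapted_lam n).mono (streamSigma_le S n) le_rfl
  cases θ
  · exact hlam.neg
  · exact hlam

theorem isLogLikelihood_lam [IsFiniteMeasure P₀] [IsFiniteMeasure P₁]
    (h : LocallyEquivalent P₀ P₁) :
    IsLogLikelihood P₁ P₀ (streamFiltration S) (lam P₀ P₁) where
  adapted := adapted_lam
  measure_eq n F hF := by
    have hlam : Measurable[streamSigma S n] (lam P₀ P₁ n) := adapted_lam n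
    have hdensity : ∀ᵐ x ∂P₀.trim (streamSigma_le S n),
        ENNReal.ofReal (Real.exp (lam P₀ P₁ n x)) =
          (P₁.trim (streamSigma_le S n)).rnDeriv (P₀.trim (streamSigma_le S n)) x := by
      filter_upwards [exp_llr_of_ac' _ _ (h n).2,
        Measure.rnDeriv_ne_top (P₁.trim (streamSigma_le S n)) (P₀.trim (streamSigma_le S n))]
        with x hx hx'
      rw [lam, hx, ENNReal.ofReal_toReal hx']
    calc P₁ F = P₁.trim (streamSigma_le S n) F := (trim_measurableSet_eq _ hF).symm
      _ = ∫⁻ x in F, (P₁.trim (streamSigma_le S n)).rnDeriv (P₀.trim (streamSigma_le S n)) x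
            ∂P₀.trim (streamSigma_le S n) := (Measure.setLIntegral_rnDeriv (h n).1 F).symm
      _ = ∫⁻ x in F, ENNReal.ofReal (Real.exp (lam P₀ P₁ n x)) ∂P₀.trim (streamSigma_le S n) :=
          (lintegral_congr_ae (ae_restrict_of_ae hdensity)).symm
      _ = ∫⁻ x in F, ENNReal.ofReal (Real.exp (lam P₀ P₁ n x)) ∂P₀ :=
          setLIntegral_trim _ (by fun_prop) hF

theorem isLogLikelihood_evidence [IsFiniteMeasure P₀] [IsFiniteMeasure P₁]
    (h : LocallyEquivalent P₀ P₁) (θ : Bool) :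
    IsLogLikelihood (streamLaw P₀ P₁ θ) (streamLaw P₀ P₁ (!θ)) (streamFiltration S)
      (evidence P₀ P₁ θ) := by
  cases θ
  · exact (isLogLikelihood_lam h).neg
  · exact (isLogLikelihood_lam h : IsLogLikelihood P₁ P₀ _ _)

theorem ae_limsup_evidence_le {I J : ℝ} (h : LimsupBound P₀ P₁ I J) (θ : Bool) :
    ∀ᵐ x ∂streamLaw P₀ P₁ θ,
      limsup (fun n : ℕ => ((evidence P₀ P₁ θ n x / n : ℝ) : EReal)) atTop ≤
        ((bif θ then I else J : ℝ) : EReal) := by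
  cases θ
  · exact h.2
  · exact h.1

theorem tsum_evidence_le_ne_top {I J : ℝ} (h : CompleteLowerConvergence P₀ P₁ I J) (θ : Bool)
    {I' : ℝ} (hI' : I' < bif θ then I else J) :
    ∑' n : ℕ, streamLaw P₀ P₁ θ {x | evidence P₀ P₁ θ (n + 1) x / ((n + 1 : ℕ) : ℝ) ≤ I'} ≠ ∞ := by
  cases θ
  · simpa [streamLaw, evidence] using (h.2 _ (sub_pos.2 hI')).ne
  · simpa [streamLaw, evidence] using (h.1 _ (sub_pos.2 hI')).ne

end Stream

section Streams

variable {K : ℕ} {E : Fin K → Type*} [∀ k, MeasurableSpace (E k)]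

theorem decentralizedProcedures_subset :
    decentralizedProcedures E ⊆ sequentialProcedures E := fun _ hχ k =>
  ⟨(hχ k).1, fun n hn => ⟨le_iSup (fun k => localSigma E k n) k _ ((hχ k).2 n hn).1,
    fun i => le_iSup (fun k => localSigma E k n) k _ (((hχ k).2 n hn).2 i)⟩⟩

variable (E) in
/-- The filtration `n ↦ 𝓕ₖ(n)`. -/
def localFiltration (k : Fin K) : Filtration ℕ (inferInstance : MeasurableSpace (Paths E)) :=
  filtrationComap (streamFiltration (E k)) (measurable_pi_apply k)

theorem measurableSet_T_eq_inter_D_eq {χ : Procedure E} (hχ : χ ∈ decentralizedProcedures E)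
    (k : Fin K) (θ : Bool) (n : ℕ) :
    MeasurableSet[localFiltration E k n] ({ω | χ.T k ω = n} ∩ {ω | χ.D k ω = θ}) := by
  rcases Nat.eq_zero_or_pos n with rfl | hn
  · have hempty : {ω | χ.T k ω = (0 : ℕ)} ∩ {ω | χ.D k ω = θ} = ∅ :=
      Set.eq_empty_of_forall_notMem fun ω hω => by simpa [hω.1.out] using (hχ k).1 ω
    exact hempty ▸ @MeasurableSet.empty _ (localFiltration E k 0)
  · exact ((hχ k).2 n hn).2 θ

theorem measurable_T {χ : Procedure E} (hχ : χ ∈ decentralizedProcedures E) (k : Fin K) :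
    Measurable (χ.T k) := by
  have hT : ∀ n : ℕ, MeasurableSet (χ.T k ⁻¹' {(n : ℕ∞)}) := fun n => by
    have hsplit : χ.T k ⁻¹' {(n : ℕ∞)} = ⋃ θ, {ω | χ.T k ω = n} ∩ {ω | χ.D k ω = θ} := by
      ext ω
      simp
    exact hsplit ▸ MeasurableSet.iUnion fun θ =>
      (localFiltration E k).le n _ (measurableSet_T_eq_inter_D_eq hχ k θ n)
  refine measurable_to_countable' fun t => ?_
  induction t with
  | coe n => exact hT n
  | top =>
    have htop : χ.T k ⁻¹' {⊤} = (⋃ n : ℕ, χ.T k ⁻¹' {(n : ℕ∞)})ᶜ := by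
      ext ω
      simpa using ENat.eq_top_iff_forall_ne.trans (forall_congr' fun _ => ne_comm)
    exact htop ▸ (MeasurableSet.iUnion hT).compl

variable {P₀ P₁ : ∀ k, Measure (ℕ → E k)} {A B : Finset (Fin K)} {k : Fin K} {θ : Bool}

theorem measure_D_eq_le_of_mem_controlledProcedures {𝒜 : Finset (Finset (Fin K))} {α β : ℝ}
    {χ : Procedure E} (hχ : χ ∈ controlledProcedures P₀ P₁ 𝒜 α β) (hA : A ∈ 𝒜)
    (hk : decide (k ∈ A) = !θ) :
    jointLaw P₀ P₁ A {ω | χ.D k ω = θ} ≤ ENNReal.ofReal (bif θ then α else β) := by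
  cases θ
  · exact (measure_mono fun ω hω => by exact ⟨k, of_decide_eq_true hk, hω⟩).trans (hχ.2 A hA).2.2
  · exact (measure_mono fun ω hω => by exact ⟨k, of_decide_eq_false hk, hω⟩).trans (hχ.2 A hA).2.1

section ParallelSPRT

variable {a b : ℝ} {ω : Paths E} {n : ℕ}

theorem parallelSPRT_T (P₀ P₁ : ∀ k, Measure (ℕ → E k)) (a b : ℝ) (k : Fin K) :
    (parallelSPRT P₀ P₁ a b).T k =
      hittingAfter (fun n ω => lam (P₀ k) (P₁ k) n (ω k)) (Set.Ioo (-b) a)ᶜ 1 := by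
  ext1 ω
  simp only [hittingAfter_def]
  split_ifs with hhit
  · exact (ENat.natCast_sInf hhit).symm
  · exact iInf₂_eq_top.2 fun n hn => absurd ⟨n, hn⟩ hhit

theorem parallelSPRT_D_eq_true_iff :
    (parallelSPRT P₀ P₁ a b).D k ω = true ↔
      ∃ n : ℕ, (parallelSPRT P₀ P₁ a b).T k ω = n ∧ a ≤ lam (P₀ k) (P₁ k) n (ω k) :=
  @decide_eq_true_iff _ (Classical.propDecidable _)

theorem parallelSPRT_D_eq_true_iff_of_T_eq (hT : (parallelSPRT P₀ P₁ a b).T k ω = n) :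
    (parallelSPRT P₀ P₁ a b).D k ω = true ↔ a ≤ lam (P₀ k) (P₁ k) n (ω k) := by
  simp [parallelSPRT_D_eq_true_iff, hT]

theorem lam_notMem_Ioo_of_parallelSPRT_T_eq (hT : (parallelSPRT P₀ P₁ a b).T k ω = n) :
    lam (P₀ k) (P₁ k) n (ω k) ∉ Set.Ioo (-b) a := by
  rw [parallelSPRT_T] at hT
  have hmem := hittingAfter_mem_set_of_ne_top (hT.trans_ne (ENat.natCast_ne_top n))
  rw [hT] at hmem
  exact hmem

theorem evidence_lt_of_lt_parallelSPRT_T (θ : Bool) (hn : 1 ≤ n)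
    (hT : n < (parallelSPRT P₀ P₁ a b).T k ω) :
    evidence (P₀ k) (P₁ k) θ n (ω k) < bif θ then a else b := by
  rw [parallelSPRT_T] at hT
  have hmem := not_not.1 (notMem_of_lt_hittingAfter hT hn)
  cases θ
  · exact neg_lt.1 hmem.1
  · exact hmem.2

theorem le_evidence_of_parallelSPRT_D_eq (hT : (parallelSPRT P₀ P₁ a b).T k ω = n)
    (hD : (parallelSPRT P₀ P₁ a b).D k ω = θ) :
    (bif θ then a else b) ≤ evidence (P₀ k) (P₁ k) θ n (ω k) := by
  cases θ
  · have hlt : lam (P₀ k) (P₁ k) n (ω k) < a := by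
      simpa [hD] using (parallelSPRT_D_eq_true_iff_of_T_eq hT).not
    have hle : lam (P₀ k) (P₁ k) n (ω k) ≤ -b :=
      not_lt.1 fun h => lam_notMem_Ioo_of_parallelSPRT_T_eq hT ⟨h, hlt⟩
    exact le_neg.1 hle
  · exact (parallelSPRT_D_eq_true_iff_of_T_eq hT).1 hD

theorem parallelSPRT_mem_decentralizedProcedures (P₀ P₁ : ∀ k, Measure (ℕ → E k)) (a b : ℝ) :
    parallelSPRT P₀ P₁ a b ∈ decentralizedProcedures E := by
  intro k
  have hadapted : Adapted (localFiltration E k) fun n ω => lam (P₀ k) (P₁ k) n (ω k) :=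
    fun n => (adapted_lam n).comp (comap_measurable _)
  have hT : IsStoppingTime (localFiltration E k) ((parallelSPRT P₀ P₁ a b).T k) :=
    parallelSPRT_T P₀ P₁ a b k ▸ hadapted.isStoppingTime_hittingAfter measurableSet_Ioo.compl
  refine ⟨fun ω => parallelSPRT_T P₀ P₁ a b k ▸ le_hittingAfter ω, fun n _ =>
    ⟨hT.measurableSet_eq n, fun θ => ?_⟩⟩
  have hsignal : MeasurableSet[localFiltration E k n]
      {ω : Paths E | a ≤ lam (P₀ k) (P₁ k) n (ω k)} := hadapted n measurableSet_Ici
  have hdecision : MeasurableSet[localFiltration E k n]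
      {ω : Paths E | a ≤ lam (P₀ k) (P₁ k) n (ω k) ↔ θ = true} := by
    cases θ
    · simp only [Bool.false_eq_true, iff_false]
      exact hsignal.compl
    · simpa using hsignal
  have hsplit : {ω | (parallelSPRT P₀ P₁ a b).T k ω = n ∧ (parallelSPRT P₀ P₁ a b).D k ω = θ} =
      {ω | (parallelSPRT P₀ P₁ a b).T k ω = n} ∩
        {ω : Paths E | a ≤ lam (P₀ k) (P₁ k) n (ω k) ↔ θ = true} := by
    ext ω
    refine and_congr_right fun hω => ?_
    rw [Set.mem_ofPred_eq, ← parallelSPRT_D_eq_true_iff_of_T_eq hω, Bool.eq_iff_iff]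
  exact hsplit ▸ (hT.measurableSet_eq n).inter hdecision

end ParallelSPRT

theorem optDecentralized_le_expectedTime_parallelSPRT {𝒜 : Finset (Finset (Fin K))}
    {a b : ℝ → ℝ → ℝ} (hab : Calibrated P₀ P₁ 𝒜 a b) (A : Finset (Fin K)) (k : Fin K) {α β : ℝ}
    (hα : α ∈ Set.Ioo (0 : ℝ) 1) (hβ : β ∈ Set.Ioo (0 : ℝ) 1) :
    optDecentralized P₀ P₁ 𝒜 A k α β ≤
      expectedTime P₀ P₁ A (parallelSPRT P₀ P₁ (a α β) (b α β)) k :=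
  iInf₂_le _ ⟨parallelSPRT_mem_decentralizedProcedures P₀ P₁ _ _, (hab.1 α hα β hβ).2.2⟩

variable [∀ k, IsProbabilityMeasure (P₀ k)] [∀ k, IsProbabilityMeasure (P₁ k)]

instance isProbabilityMeasure_marginal (A : Finset (Fin K)) (k : Fin K) :
    IsProbabilityMeasure (if k ∈ A then P₁ k else P₀ k) := by
  split_ifs <;> infer_instance

instance isProbabilityMeasure_jointLaw (A : Finset (Fin K)) :
    IsProbabilityMeasure (jointLaw P₀ P₁ A) := by
  unfold jointLaw; infer_instance

theorem measurePreserving_eval_jointLaw (hk : decide (k ∈ A) = θ) :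
    MeasurePreserving (fun ω : Paths E => ω k) (jointLaw P₀ P₁ A)
      (streamLaw (P₀ k) (P₁ k) θ) := by
  rw [streamLaw, ← hk, Bool.cond_decide]
  exact measurePreserving_eval (fun k => if k ∈ A then P₁ k else P₀ k) k

theorem isLogLikelihood_jointLaw (hac : ∀ k, LocallyEquivalent (P₀ k) (P₁ k))
    (hA : decide (k ∈ A) = θ) (hB : decide (k ∈ B) = !θ) :
    IsLogLikelihood (jointLaw P₀ P₁ A) (jointLaw P₀ P₁ B) (localFiltration E k)
      fun n ω => evidence (P₀ k) (P₁ k) θ n (ω k) :=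
  (isLogLikelihood_evidence (hac k) θ).comap (measurePreserving_eval_jointLaw hA)
    (measurePreserving_eval_jointLaw hB)

theorem ae_limsup_evidence_le_jointLaw {I J : ℝ} (h : LimsupBound (P₀ k) (P₁ k) I J)
    (hA : decide (k ∈ A) = θ) :
    ∀ᵐ ω ∂jointLaw P₀ P₁ A,
      limsup (fun n : ℕ => ((evidence (P₀ k) (P₁ k) θ n (ω k) / n : ℝ) : EReal)) atTop ≤
        ((bif θ then I else J : ℝ) : EReal) :=
  (measurePreserving_eval_jointLaw hA).quasiMeasurePreserving.ae (ae_limsup_evidence_le h θ)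

theorem tsum_jointLaw_evidence_le_ne_top {I J : ℝ}
    (h : CompleteLowerConvergence (P₀ k) (P₁ k) I J) (hA : decide (k ∈ A) = θ) {I' : ℝ}
    (hI' : I' < bif θ then I else J) :
    ∑' n : ℕ, jointLaw P₀ P₁ A
      {ω | evidence (P₀ k) (P₁ k) θ (n + 1) (ω k) / ((n + 1 : ℕ) : ℝ) ≤ I'} ≠ ∞ := by
  have hm : ∀ n, MeasurableSet {x | evidence (P₀ k) (P₁ k) θ (n + 1) x / ((n + 1 : ℕ) : ℝ) ≤ I'} :=
    fun n => measurableSet_le ((measurable_evidence θ (n + 1)).div_const _) measurable_const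
  refine (tsum_congr fun n => ?_).trans_ne (tsum_evidence_le_ne_top h θ hI')
  exact (measurePreserving_eval_jointLaw hA).measure_preimage (hm n).nullMeasurableSet

theorem ae_parallelSPRT_T_lt_top {I J : ℝ} (hI : 0 < I) (hJ : 0 < J)
    (h : CompleteLowerConvergence (P₀ k) (P₁ k) I J) (A : Finset (Fin K)) (a b : ℝ) :
    ∀ᵐ ω ∂jointLaw P₀ P₁ A, (parallelSPRT P₀ P₁ a b).T k ω < ⊤ := by
  obtain ⟨θ, hA⟩ : ∃ θ, decide (k ∈ A) = θ := ⟨_, rfl⟩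
  have hrate : 0 < bif θ then I else J := by cases θ <;> assumption
  filter_upwards [ae_exists_le_of_tsum_ne_top
    (ℓ := fun n (ω : Paths E) => evidence (P₀ k) (P₁ k) θ n (ω k)) (half_pos hrate)
    (tsum_jointLaw_evidence_le_ne_top h hA (half_lt_self hrate)) (bif θ then a else b)]
    with ω ⟨n, hn, hle⟩
  by_contra hT
  rw [not_lt_top_iff] at hT
  exact (evidence_lt_of_lt_parallelSPRT_T θ hn (hT ▸ ENat.natCast_lt_top n)).not_ge hle

theorem measure_parallelSPRT_D_eq_le {a b : ℝ} (hac : ∀ k, LocallyEquivalent (P₀ k) (P₁ k))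
    (hT : ∀ᵐ ω ∂jointLaw P₀ P₁ A, (parallelSPRT P₀ P₁ a b).T k ω < ⊤)
    (hA : decide (k ∈ A) = !θ) :
    jointLaw P₀ P₁ A {ω | (parallelSPRT P₀ P₁ a b).D k ω = θ} ≤
      ENNReal.ofReal (Real.exp (-bif θ then a else b)) := by
  have hlik : IsLogLikelihood (jointLaw P₀ P₁ A) (jointLaw P₀ P₁ Aᶜ) (localFiltration E k)
      fun n ω => evidence (P₀ k) (P₁ k) (!θ) n (ω k) :=
    isLogLikelihood_jointLaw hac hA (by simp [hA])
  have hwald := hlik.measure_exists_eq_inter_le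
    (measurableSet_T_eq_inter_D_eq (parallelSPRT_mem_decentralizedProcedures P₀ P₁ a b) k θ)
    (-bif θ then a else b)
  refine (measure_mono_ae ?_).trans (hwald.trans (mul_le_of_le_one_right' prob_le_one))
  filter_upwards [hT] with ω hω hD
  obtain ⟨n, hn⟩ := ENat.ne_top_iff_exists.1 hω.ne
  refine ⟨⟨n, hn.symm, ?_⟩, hD⟩
  rw [evidence_not]
  exact neg_le_neg (le_evidence_of_parallelSPRT_D_eq hn.symm hD)

theorem measure_exists_parallelSPRT_D_eq_le {a b : ℝ}
    (hac : ∀ k, LocallyEquivalent (P₀ k) (P₁ k))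
    (hT : ∀ k, ∀ᵐ ω ∂jointLaw P₀ P₁ A, (parallelSPRT P₀ P₁ a b).T k ω < ⊤)
    {s : Finset (Fin K)} (hs : ∀ k ∈ s, decide (k ∈ A) = !θ) :
    jointLaw P₀ P₁ A {ω | ∃ k ∈ s, (parallelSPRT P₀ P₁ a b).D k ω = θ} ≤
      ENNReal.ofReal (s.card * Real.exp (-bif θ then a else b)) := by
  have hunion : {ω | ∃ k ∈ s, (parallelSPRT P₀ P₁ a b).D k ω = θ} =
      ⋃ k ∈ s, {ω | (parallelSPRT P₀ P₁ a b).D k ω = θ} := by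
    ext ω
    simp
  calc jointLaw P₀ P₁ A {ω | ∃ k ∈ s, (parallelSPRT P₀ P₁ a b).D k ω = θ}
      ≤ ∑ k ∈ s, jointLaw P₀ P₁ A {ω | (parallelSPRT P₀ P₁ a b).D k ω = θ} :=
        hunion ▸ measure_biUnion_finset_le _ _
    _ ≤ s.card • ENNReal.ofReal (Real.exp (-bif θ then a else b)) :=
        Finset.sum_le_card_nsmul _ _ _ fun k hk => measure_parallelSPRT_D_eq_le hac (hT k) (hs k hk)
    _ = ENNReal.ofReal (s.card * Real.exp (-bif θ then a else b)) := by
        rw [nsmul_eq_mul, ENNReal.ofReal_mul (Nat.cast_nonneg _), ENNReal.ofReal_natCast]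

theorem FWE1_parallelSPRT_le {a b : ℝ} (hac : ∀ k, LocallyEquivalent (P₀ k) (P₁ k))
    (hT : ∀ k, ∀ᵐ ω ∂jointLaw P₀ P₁ A, (parallelSPRT P₀ P₁ a b).T k ω < ⊤) :
    FWE1 P₀ P₁ A (parallelSPRT P₀ P₁ a b) ≤ ENNReal.ofReal (Aᶜ.card * Real.exp (-a)) := by
  simpa [FWE1] using measure_exists_parallelSPRT_D_eq_le (θ := true) (s := Aᶜ) hac hT (by simp)

theorem FWE2_parallelSPRT_le {a b : ℝ} (hac : ∀ k, LocallyEquivalent (P₀ k) (P₁ k))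
    (hT : ∀ k, ∀ᵐ ω ∂jointLaw P₀ P₁ A, (parallelSPRT P₀ P₁ a b).T k ω < ⊤) :
    FWE2 P₀ P₁ A (parallelSPRT P₀ P₁ a b) ≤ ENNReal.ofReal (A.card * Real.exp (-b)) :=
  measure_exists_parallelSPRT_D_eq_le (θ := false) hac hT (by simp)

theorem natCast_mul_exp_neg_le {n s : ℕ} (hns : n ≤ s) {α : ℝ} (hα : α ∈ Set.Ioo (0 : ℝ) 1) :
    (n : ℝ) * Real.exp (-(|Real.log α| + Real.log s)) ≤ α := by
  rcases Nat.eq_zero_or_pos s with rfl | hs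
  · obtain rfl : n = 0 := Nat.le_zero.1 hns
    simpa using hα.1.le
  · have hs0 : (0 : ℝ) < s := Nat.cast_pos.2 hs
    calc (n : ℝ) * Real.exp (-(|Real.log α| + Real.log s))
        = n * (α / s) := by
          rw [abs_of_neg (Real.log_neg hα.1 hα.2), neg_add, neg_neg, Real.exp_add,
            Real.exp_log hα.1, Real.exp_neg, Real.exp_log hs0, div_eq_mul_inv]
      _ ≤ s * (α / s) := by
          have := hα.1
          gcongr
      _ = α := mul_div_cancel₀ α hs0.ne'

theorem calibrated_bonferroni (hac : ∀ k, LocallyEquivalent (P₀ k) (P₁ k)) {I J : Fin K → ℝ}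
    (hI : ∀ k, 0 < I k) (hJ : ∀ k, 0 < J k)
    (hcomplete : ∀ k, CompleteLowerConvergence (P₀ k) (P₁ k) (I k) (J k))
    (𝒜 : Finset (Finset (Fin K))) :
    Calibrated P₀ P₁ 𝒜
      (fun α _ => |Real.log α| + Real.log (𝒜.sup fun A => Aᶜ.card : ℕ))
      (fun _ β => |Real.log β| + Real.log (𝒜.sup fun A => A.card : ℕ)) := by
  have hpos : ∀ α ∈ Set.Ioo (0 : ℝ) 1, ∀ s : ℕ, 0 < |Real.log α| + Real.log s := fun α hα s =>
    add_pos_of_pos_of_nonneg (abs_pos.2 (Real.log_neg hα.1 hα.2).ne) (Real.log_natCast_nonneg s)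
  refine ⟨fun α hα β hβ => ⟨hpos α hα _, hpos β hβ _,
    decentralizedProcedures_subset (parallelSPRT_mem_decentralizedProcedures P₀ P₁ _ _),
    fun A hA => ?_⟩, tendsto_abs_log_add_div tendsto_fst _, tendsto_abs_log_add_div tendsto_snd _⟩
  have hT := fun k => ae_parallelSPRT_T_lt_top (hI k) (hJ k) (hcomplete k) A
    (|Real.log α| + Real.log (𝒜.sup fun A => Aᶜ.card : ℕ))
    (|Real.log β| + Real.log (𝒜.sup fun A => A.card : ℕ))
  refine ⟨hT, (FWE1_parallelSPRT_le hac hT).trans (ENNReal.ofReal_le_ofReal ?_),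
    (FWE2_parallelSPRT_le hac hT).trans (ENNReal.ofReal_le_ofReal ?_)⟩
  · exact natCast_mul_exp_neg_le (Finset.le_sup (f := fun A : Finset (Fin K) => Aᶜ.card) hA) hα
  · exact natCast_mul_exp_neg_le (Finset.le_sup (f := fun A : Finset (Fin K) => A.card) hA) hβ

theorem tendsto_cond_fst_snd {X : Type*} {l : Filter X} (θ : Bool) :
    Tendsto (fun p : X × X => bif θ then p.1 else p.2) (l ×ˢ l) l := by
  cases θ
  · exact tendsto_snd
  · exact tendsto_fst

variable {𝒜 : Finset (Finset (Fin K))} {I J : ℝ}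

theorem eventually_le_optDecentralized (hac : ∀ k, LocallyEquivalent (P₀ k) (P₁ k))
    (hI : 0 < I) (hJ : 0 < J) (hlimsup : LimsupBound (P₀ k) (P₁ k) I J)
    (hA𝒜 : A ∈ 𝒜) (hB𝒜 : B ∈ 𝒜) (hA : decide (k ∈ A) = θ) (hB : decide (k ∈ B) = !θ) {q : ℝ}
    (hq : q ∈ Set.Ioo (0 : ℝ) 1) :
    ∀ᶠ p : ℝ × ℝ in 𝓝[>] 0 ×ˢ 𝓝[>] 0,
      ENNReal.ofReal (q * (|Real.log (bif θ then p.1 else p.2)| / bif θ then I else J)) ≤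
        optDecentralized P₀ P₁ 𝒜 A k p.1 p.2 := by
  have hrate : 0 < bif θ then I else J := by cases θ <;> assumption
  filter_upwards [(isLogLikelihood_jointLaw hac hA hB).eventually_forall_le_lintegral hrate
    (ae_limsup_evidence_le_jointLaw hlimsup hA) (tendsto_cond_fst_snd θ) (tendsto_cond_fst_snd !θ)
    hq] with p hp
  refine le_iInf₂ fun χ hχ => hp (χ.T k) {ω | χ.D k ω = θ} (measurable_T hχ.1 k)
    (measurableSet_T_eq_inter_D_eq hχ.1 k θ)
    (measure_D_eq_le_of_mem_controlledProcedures hχ.2 hB𝒜 hB) ?_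
  have hmiss : {ω | χ.D k ω = θ}ᶜ = {ω | χ.D k ω = !θ} := by
    ext ω
    simp [Bool.eq_not]
  rw [hmiss]
  exact measure_D_eq_le_of_mem_controlledProcedures hχ.2 hA𝒜 (by simpa using hA)

theorem eventually_expectedTime_parallelSPRT_le (hI : 0 < I) (hJ : 0 < J)
    (hcomplete : CompleteLowerConvergence (P₀ k) (P₁ k) I J) {a b : ℝ → ℝ → ℝ}
    (hab : Calibrated P₀ P₁ 𝒜 a b) (hA : decide (k ∈ A) = θ) {s : ℝ} (hs : 1 < s) :
    ∀ᶠ p : ℝ × ℝ in 𝓝[>] 0 ×ˢ 𝓝[>] 0,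
      expectedTime P₀ P₁ A (parallelSPRT P₀ P₁ (a p.1 p.2) (b p.1 p.2)) k ≤
        ENNReal.ofReal (s * (|Real.log (bif θ then p.1 else p.2)| / bif θ then I else J)) := by
  have hthreshold : Tendsto (fun p : ℝ × ℝ =>
      (bif θ then a p.1 p.2 else b p.1 p.2) / |Real.log (bif θ then p.1 else p.2)|)
      (𝓝[>] 0 ×ˢ 𝓝[>] 0) (𝓝 1) := by
    cases θ
    exacts [hab.2.2, hab.2.1]
  exact eventually_lintegral_le (ℓ := fun n (ω : Paths E) => evidence (P₀ k) (P₁ k) θ n (ω k))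
    (fun n => (measurable_evidence θ n).comp (measurable_pi_apply k))
    (by cases θ <;> assumption : 0 < bif θ then I else J)
    (fun _ => tsum_jointLaw_evidence_le_ne_top hcomplete hA) (tendsto_cond_fst_snd θ) hthreshold
    (T := fun p => (parallelSPRT P₀ P₁ (a p.1 p.2) (b p.1 p.2)).T k)
    (fun _ _ _ => evidence_lt_of_lt_parallelSPRT_T θ) hs

theorem asympEq_parallelSPRT_optDecentralized (hac : ∀ k, LocallyEquivalent (P₀ k) (P₁ k))
    (hI : 0 < I) (hJ : 0 < J) (hlimsup : LimsupBound (P₀ k) (P₁ k) I J)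
    (hcomplete : CompleteLowerConvergence (P₀ k) (P₁ k) I J) {a b : ℝ → ℝ → ℝ}
    (hab : Calibrated P₀ P₁ 𝒜 a b) (hA𝒜 : A ∈ 𝒜) (hB𝒜 : B ∈ 𝒜) (hA : decide (k ∈ A) = θ)
    (hB : decide (k ∈ B) = !θ) :
    AsympEq (fun α β => expectedTime P₀ P₁ A (parallelSPRT P₀ P₁ (a α β) (b α β)) k)
        (fun α β => optDecentralized P₀ P₁ 𝒜 A k α β) ∧
      AsympEq (fun α β => optDecentralized P₀ P₁ 𝒜 A k α β)
        (fun α β => ENNReal.ofReal (|Real.log (bif θ then α else β)| / bif θ then I else J)) ∧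
      AsympEq (fun α β => expectedTime P₀ P₁ A (parallelSPRT P₀ P₁ (a α β) (b α β)) k)
        (fun α β => ENNReal.ofReal (|Real.log (bif θ then α else β)| / bif θ then I else J)) := by
  have hrate : 0 < bif θ then I else J := by cases θ <;> assumption
  have hbenchmark : Tendsto (fun p : ℝ × ℝ =>
      |Real.log (bif θ then p.1 else p.2)| / bif θ then I else J) (𝓝[>] 0 ×ˢ 𝓝[>] 0) atTop :=
    (tendsto_abs_log_atTop (tendsto_cond_fst_snd θ)).atTop_div_const hrate
  refine tendsto_div_one_of_squeeze (hbenchmark.eventually_gt_atTop 0)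
    (fun q => eventually_le_optDecentralized hac hI hJ hlimsup hA𝒜 hB𝒜 hA hB) ?_
    (fun s => eventually_expectedTime_parallelSPRT_le hI hJ hcomplete hab hA)
  have hunit : ∀ᶠ x : ℝ in 𝓝[>] 0, x ∈ Set.Ioo (0 : ℝ) 1 := Ioo_mem_nhdsGT one_pos
  filter_upwards [tendsto_fst.eventually hunit, tendsto_snd.eventually hunit] with p hα hβ
  exact optDecentralized_le_expectedTime_parallelSPRT hab A k hα hβ

end Streams

end MultiTest

theorem theorem4p2 {K : ℕ} {E : Fin K → Type*} [∀ k, MeasurableSpace (E k)]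
    (P₀ P₁ : ∀ k, Measure (ℕ → E k))
    [∀ k, IsProbabilityMeasure (P₀ k)] [∀ k, IsProbabilityMeasure (P₁ k)]
    (hac : ∀ k, LocallyEquivalent (P₀ k) (P₁ k))
    (I J : Fin K → ℝ) (hI : ∀ k, 0 < I k) (hJ : ∀ k, 0 < J k)
    (hlimsup : ∀ k, LimsupBound (P₀ k) (P₁ k) (I k) (J k))
    (hcomplete : ∀ k, CompleteLowerConvergence (P₀ k) (P₁ k) (I k) (J k))
    (𝒜 : Finset (Finset (Fin K)))
    (h𝒜 : ∀ k, ∃ A ∈ 𝒜, ∃ B ∈ 𝒜, k ∈ A ∧ k ∉ B) :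
    -- asymptotic optimality among decentralized procedures, for all admissible thresholds
    (∀ a b : ℝ → ℝ → ℝ, Calibrated P₀ P₁ 𝒜 a b →
      (∀ α ∈ Set.Ioo (0 : ℝ) 1, ∀ β ∈ Set.Ioo (0 : ℝ) 1,
        parallelSPRT P₀ P₁ (a α β) (b α β) ∈
          decentralizedProcedures E ∩ controlledProcedures P₀ P₁ 𝒜 α β) ∧
      ∀ A ∈ 𝒜,
        (∀ i ∈ A,
          AsympEq (fun α β => expectedTime P₀ P₁ A (parallelSPRT P₀ P₁ (a α β) (b α β)) i)
            (fun α β => optDecentralized P₀ P₁ 𝒜 A i α β) ∧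
          AsympEq (fun α β => optDecentralized P₀ P₁ 𝒜 A i α β)
            (fun α _ => ENNReal.ofReal (|Real.log α| / I i)) ∧
          AsympEq (fun α β => expectedTime P₀ P₁ A (parallelSPRT P₀ P₁ (a α β) (b α β)) i)
            (fun α _ => ENNReal.ofReal (|Real.log α| / I i))) ∧
        (∀ j ∉ A,
          AsympEq (fun α β => expectedTime P₀ P₁ A (parallelSPRT P₀ P₁ (a α β) (b α β)) j)
            (fun α β => optDecentralized P₀ P₁ 𝒜 A j α β) ∧
          AsympEq (fun α β => optDecentralized P₀ P₁ 𝒜 A j α β)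
            (fun _ β => ENNReal.ofReal (|Real.log β| / J j)) ∧
          AsympEq (fun α β => expectedTime P₀ P₁ A (parallelSPRT P₀ P₁ (a α β) (b α β)) j)
            (fun _ β => ENNReal.ofReal (|Real.log β| / J j)))) ∧
    -- an explicit choice of admissible thresholds
    Calibrated P₀ P₁ 𝒜
      (fun α _ => |Real.log α| + Real.log (𝒜.sup fun A => Aᶜ.card : ℕ))
      (fun _ β => |Real.log β| + Real.log (𝒜.sup fun A => A.card : ℕ)) := by
  refine ⟨fun a b hab => ⟨fun α hα β hβ =>
    ⟨parallelSPRT_mem_decentralizedProcedures P₀ P₁ _ _, (hab.1 α hα β hβ).2.2⟩,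
    fun A hA => ⟨fun i hi => ?_, fun j hj => ?_⟩⟩, calibrated_bonferroni hac hI hJ hcomplete 𝒜⟩
  · obtain ⟨-, -, B, hB, -, hiB⟩ := h𝒜 i
    exact asympEq_parallelSPRT_optDecentralized (θ := true) hac (hI i) (hJ i) (hlimsup i)
      (hcomplete i) hab hA hB (decide_eq_true hi) (decide_eq_false hiB)
  · obtain ⟨B, hB, -, -, hjB, -⟩ := h𝒜 j
    exact asympEq_parallelSPRT_optDecentralized (θ := false) hac (hI j) (hJ j) (hlimsup j)
      (hcomplete j) hab hA hB (decide_eq_false hj) (decide_eq_true hjB)
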